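/- For a finite group $G$ let $\pi(G)$ be the set of primes dividing $|G|$. The prime simplicial complex $\Pi(G)$ consists of all subsets $S\subseteq\pi(G)$ such that $G$ has an element of order $\prod_{r\in S} r$, ordered by inclusion; it is called pure if all its maximal simplices have the same cardinality. Proposition. Let $q\ge 4$ be a power of a prime $p$, and let $G=\mathrm{PSL}_2(q)$ be the projective special linear group of degree $2$ over the field with $q$ elements. Then: (1) $\Pi(G)$ is pure if and only if $q\in\{4,5,7,8,9,17\}$; (2) $p$ is an isolated vertex of $\Pi(G)$, that is, $\{p\}\in\Pi(G)$ and $\{p\}$ is the only simplex of $\Pi(G)$ containing $p$; (3) $\Pi(G)$ is pure if and only if every element of $G$ has prime-power order (where the order $1=r^0$ of the identity counts as a prime power). -/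

import Mathlib

/-- The prime simplicial complex `Π(G)` of a finite group `G`: the sets `S` of primes dividing the
order of `G` such that `G` has an element whose order is the product of the primes in `S`.
Simplices are ordered by inclusion. -/
def primeSimplicialComplex (G : Type*) [Group G] [Finite G] : Set (Finset ℕ) :=
  {S | S ⊆ (Nat.card G).primeFactors ∧ ∃ g : G, orderOf g = ∏ r ∈ S, r}

/-- A simplex of `K` that is not properly contained in another simplex of `K`. -/
def IsMaximalSimplex (K : Set (Finset ℕ)) (S : Finset ℕ) : Prop :=
  Maximal (fun T => T ∈ K) S

/-- A complex is pure if all its maximal simplices have the same cardinality. -/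
def IsPureComplex (K : Set (Finset ℕ)) : Prop :=
  ∀ S T : Finset ℕ, IsMaximalSimplex K S → IsMaximalSimplex K T → S.card = T.card

/-- A vertex `v` of `K` is isolated if `{v}` is the only simplex of `K` that contains `v`. -/
def IsIsolatedVertex (K : Set (Finset ℕ)) (v : ℕ) : Prop :=
  {v} ∈ K ∧ ∀ S ∈ K, v ∈ S → S = {v}

/-! Everything is read off from element orders. A matrix in `SL₂(q)` has eigenvalues `l`, `l⁻¹` in
an algebraic closure. If they coincide, its image has order dividing `p`; otherwise Frobenius fixes
or swaps them, so the order divides `(q ∓ 1) / gcd(2, q ∓ 1)` (`orderOf_psl_two_dvd`). Hence `p` is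
isolated, `{p}` is a maximal simplex, and purity means that all orders are prime powers. Orders
large enough to be multiplied by 2 into multiples of `q ∓ 1` occur, so purity makes `q - 1` and `q +
1` divide twice a prime power, which reduces to `3 ^ k ± 1 = 2 ^ b`. -/

/-! ### Arithmetic of neighbouring prime powers -/

theorem three_pow_add_one_eq_two_pow {k b : ℕ} (h : 3 ^ k + 1 = 2 ^ b) : 2 ^ b = 2 ∨ 2 ^ b = 4 := by
  have h8 : 3 ^ k % 8 = 1 ∨ 3 ^ k % 8 = 3 := by
    clear h
    induction k with
    | zero => simp
    | succ n ih => rw [pow_succ]; omega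
  have hb : b < 3 := by
    by_contra! hb
    have : 2 ^ 3 ∣ 2 ^ b := pow_dvd_pow 2 hb
    omega
  interval_cases b <;> simp_all

theorem two_pow_add_one_eq_three_pow {k b : ℕ} (h : 2 ^ b + 1 = 3 ^ k) : 2 ^ b = 2 ∨ 2 ^ b = 8 := by
  have h3 : ∀ j, 3 ^ j % 2 = 1 := fun j => by
    induction j with
    | zero => rfl
    | succ n ih => rw [pow_succ]; omega
  rcases Nat.lt_or_ge b 2 with hb | hb
  · interval_cases b
    · have := h3 k; omega
    · simp
  have h4 : 4 ∣ 2 ^ b := pow_dvd_pow 2 hb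
  -- For even exponent, `3 ^ k - 1` factors as a difference of squares; for odd exponent, it is 2
  -- mod 4.
  obtain ⟨j, rfl | rfl⟩ := k.even_or_odd'
  · have h1 : 1 ≤ 3 ^ j := Nat.one_le_pow _ _ (by norm_num)
    have hmul : (3 ^ j - 1) * (3 ^ j + 1) = 2 ^ b := by
      obtain ⟨x, hx⟩ := Nat.exists_eq_add_of_le h1
      rw [mul_comm 2 j, pow_mul] at h
      rw [hx] at h ⊢
      rw [Nat.add_sub_cancel_left]
      nlinarith
    obtain ⟨c, -, hc⟩ := (Nat.dvd_prime_pow Nat.prime_two).1 (Dvd.intro_left _ hmul)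
    rcases three_pow_add_one_eq_two_pow hc with h' | h' <;> rw [hc, h'] at hmul
    · have : 3 ^ j = 1 := by omega
      rw [this] at hmul; simp at hmul
      have := Nat.two_pow_pos b; omega
    · have : 3 ^ j = 3 := by omega
      rw [this] at hmul; omega
  · have : 3 ^ (2 * j + 1) % 4 = 3 := by
      clear h
      induction j with
      | zero => rfl
      | succ n ih => rw [show 2 * (n + 1) + 1 = 2 * n + 1 + 2 by ring, pow_add]; omega
    omega


/-- For even `q`, the numbers `q - 1`, `q`, `q + 1` are prime powers; for `q = 2 * a + 1`, so are
`a`, `a + 1`, `2 * a + 1`. One of the three is a power of 2, and 3 divides another. -/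
theorem card_mem_of_dvd_two_mul_prime_pow {q p r s m k l : ℕ} (hp : p.Prime) (hr : r.Prime)
    (hs : s.Prime) (hq : q = p ^ m) (h4 : 4 ≤ q) (hsub : q - 1 ∣ 2 * r ^ k)
    (hadd : q + 1 ∣ 2 * s ^ l) : q ∈ ({4, 5, 7, 8, 9, 17} : Set ℕ) := by
  simp only [Set.mem_insert_iff, Set.mem_singleton_iff]
  have key : ∀ {t n : ℕ} (u), t.Prime → u.Prime → (∃ m, n = t ^ m) → u ∣ n → ∃ j, n = u ^ j := by
    rintro t _ u ht hu ⟨m, rfl⟩ h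
    obtain rfl := (Nat.prime_dvd_prime_iff_eq hu ht).1 (hu.dvd_of_dvd_pow h)
    exact ⟨m, rfl⟩
  have h2 := Nat.prime_two
  have h3 := Nat.prime_three
  by_cases hpar : 2 ∣ q
  · obtain ⟨e, he⟩ := key 2 hp h2 ⟨m, hq⟩ hpar
    have hsub' : ∃ i, q - 1 = r ^ i := by
      obtain ⟨i, -, hi⟩ := (Nat.dvd_prime_pow hr).1 <|
        ((h2.coprime_iff_not_dvd.2 (by omega) : Nat.Coprime 2 (q - 1)).symm).dvd_of_dvd_mul_left hsub
      exact ⟨i, hi⟩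
    have hadd' : ∃ i, q + 1 = s ^ i := by
      obtain ⟨i, -, hi⟩ := (Nat.dvd_prime_pow hs).1 <|
        ((h2.coprime_iff_not_dvd.2 (by omega) : Nat.Coprime 2 (q + 1)).symm).dvd_of_dvd_mul_left hadd
      exact ⟨i, hi⟩
    have hmod : 3 ∣ q - 1 ∨ 3 ∣ q + 1 := by
      have : ¬ 3 ∣ q := fun h => by
        have := (Nat.prime_dvd_prime_iff_eq h3 h2).1 (h3.dvd_of_dvd_pow (he ▸ h))
        omega
      rcases (by omega : q % 3 = 1 ∨ q % 3 = 2) with h | h <;> omega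
    rcases hmod with h | h
    · obtain ⟨j, hj⟩ := key 3 hr h3 hsub' h
      have := three_pow_add_one_eq_two_pow (k := j) (b := e) (by omega)
      omega
    · obtain ⟨j, hj⟩ := key 3 hs h3 hadd' h
      have := two_pow_add_one_eq_three_pow (k := j) (b := e) (by omega)
      omega
  · obtain ⟨a, rfl⟩ : ∃ a, q = 2 * a + 1 := ⟨q / 2, by omega⟩
    rw [Nat.add_sub_cancel, Nat.mul_dvd_mul_iff_left two_pos, Nat.dvd_prime_pow hr] at hsub
    rw [show 2 * a + 1 + 1 = 2 * (a + 1) by ring, Nat.mul_dvd_mul_iff_left two_pos,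
      Nat.dvd_prime_pow hs] at hadd
    have hsub' : ∃ i, a = r ^ i := hsub.imp fun _ h => h.2
    have hadd' : ∃ i, a + 1 = s ^ i := hadd.imp fun _ h => h.2
    clear hsub hadd
    have hthree : ∀ e, ¬ 3 ∣ 2 ^ e := fun e h => by
      have := (Nat.prime_dvd_prime_iff_eq h3 h2).1 (h3.dvd_of_dvd_pow h)
      omega
    rcases Nat.even_or_odd a with ha | ha
    · obtain ⟨e, he⟩ := key 2 hr h2 hsub' ha.two_dvd
      have := hthree e
      have hmod : 3 ∣ a + 1 ∨ 3 ∣ 2 * a + 1 := by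
        rcases (by omega : a % 3 = 1 ∨ a % 3 = 2) with h | h <;> omega
      rcases hmod with h | h
      · obtain ⟨j, hj⟩ := key 3 hs h3 hadd' h
        have := two_pow_add_one_eq_three_pow (k := j) (b := e) (by omega)
        omega
      · obtain ⟨j, hj⟩ := key 3 hp h3 ⟨m, hq⟩ h
        have := two_pow_add_one_eq_three_pow (k := j) (b := e + 1) (by rw [pow_succ]; omega)
        rw [pow_succ] at this
        omega
    · obtain ⟨e, he⟩ := key 2 hs h2 hadd' ha.add_one.two_dvd
      have := hthree e
      have hmod : 3 ∣ a ∨ 3 ∣ 2 * a + 1 := by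
        rcases (by omega : a % 3 = 0 ∨ a % 3 = 1) with h | h <;> omega
      rcases hmod with h | h
      · obtain ⟨j, hj⟩ := key 3 hr h3 hsub' h
        have := three_pow_add_one_eq_two_pow (k := j) (b := e) (by omega)
        omega
      · obtain ⟨j, hj⟩ := key 3 hp h3 ⟨m, hq⟩ h
        have := three_pow_add_one_eq_two_pow (k := j) (b := e + 1) (by rw [pow_succ]; omega)
        rw [pow_succ] at this
        clear key hthree hsub' hadd'
        omega

/-! ### Element orders in `PSL₂(q)` -/

section SpecialLinear

open Polynomial Matrix

theorem pow_mem_center_of_charpoly_dvd {F : Type*} [Field F] (A : SpecialLinearGroup (Fin 2) F)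
    {n : ℕ} {c : F} (h : A.1.charpoly ∣ X ^ n - C c) :
    A ^ n ∈ Subgroup.center (SpecialLinearGroup (Fin 2) F) := by
  have hA : A.1 ^ n = scalar (Fin 2) c := by
    have := aeval_eq_zero_of_dvd_aeval_eq_zero h (aeval_self_charpoly A.1)
    rw [map_sub, map_pow, aeval_X, aeval_C, sub_eq_zero] at this
    exact this
  refine Matrix.SpecialLinearGroup.mem_center_iff.2 ⟨c, ?_, by rw [← hA]; rfl⟩
  have := congrArg det hA
  simpa using this.symm

theorem charpoly_map_eq_mul {F K : Type*} [Field F] [Field K] [Algebra F K]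
    (A : SpecialLinearGroup (Fin 2) F) {l : K} (hl : aeval l A.1.charpoly = 0) :
    l ≠ 0 ∧ algebraMap F K A.1.trace = l + l⁻¹ ∧
      A.1.charpoly.map (algebraMap F K) = (X - C l) * (X - C l⁻¹) := by
  rw [charpoly_fin_two, A.2] at hl ⊢
  simp only [map_add, map_sub, map_mul, aeval_X, aeval_C, map_pow, map_one] at hl
  have h0 : l ≠ 0 := by rintro rfl; simp at hl
  have ht : algebraMap F K A.1.trace = l + l⁻¹ := by
    field_simp
    linear_combination -hl
  refine ⟨h0, ht, ?_⟩
  have h1 : (C l * C l⁻¹ : K[X]) = 1 := by rw [← C_mul, mul_inv_cancel₀ h0, C_1]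
  simp only [Polynomial.map_add, Polynomial.map_sub, Polynomial.map_mul, Polynomial.map_pow, map_X, map_C, ht, C_add, map_one,
    Polynomial.map_one]
  linear_combination -h1

theorem pow_div_gcd_eq_one_or_neg_one {K : Type*} [Field K] {l : K} {n : ℕ} (hl : l ^ n = 1) :
    l ^ (n / n.gcd 2) = 1 ∨ l ^ (n / n.gcd 2) = -1 := by
  rw [← sq_eq_one_iff]
  rw [← pow_mul]
  obtain ⟨m, hm⟩ : n ∣ n / n.gcd 2 * 2 := by
    conv_lhs => rw [← Nat.div_mul_cancel (Nat.gcd_dvd_left n 2)]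
    exact mul_dvd_mul_left _ (Nat.gcd_dvd_right n 2)
  rw [hm, pow_mul, hl, one_pow]

/-- Halving an even exponent costs only a sign, the same for `l` and `l⁻¹`, so the power is still
scalar. -/
theorem pow_mem_center_of_root_pow {F K : Type*} [Field F] [Field K] [Algebra F K]
    (A : SpecialLinearGroup (Fin 2) F) {l : K} (hl : aeval l A.1.charpoly = 0)
    (hne : l ≠ l⁻¹) {n : ℕ} (hn : l ^ n = 1) :
    A ^ (n / n.gcd 2) ∈ Subgroup.center (SpecialLinearGroup (Fin 2) F) := by
  obtain ⟨h0, ht, hc⟩ := charpoly_map_eq_mul A hl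
  obtain ⟨c, hcl, hcl'⟩ : ∃ c : F, l ^ (n / n.gcd 2) = algebraMap F K c ∧
      l⁻¹ ^ (n / n.gcd 2) = algebraMap F K c := by
    rcases pow_div_gcd_eq_one_or_neg_one hn with h | h
    · exact ⟨1, by simp [h], by simp [h]⟩
    · exact ⟨-1, by simp [h], by simp [h, inv_neg]⟩
  refine pow_mem_center_of_charpoly_dvd A (c := c) ?_
  rw [← map_dvd_map' (algebraMap F K), hc]
  refine (isCoprime_X_sub_C_of_isUnit_sub (sub_ne_zero.2 hne).isUnit).mul_dvd ?_ ?_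
  · simp [dvd_iff_isRoot, hcl]
  · rw [dvd_iff_isRoot]; simp [← hcl', IsRoot]

theorem pow_char_mem_center {F K : Type*} [Field F] [Field K] [Algebra F K] (p : ℕ) [Fact p.Prime]
    [CharP F p] (A : SpecialLinearGroup (Fin 2) F) {l : K} (hl : aeval l A.1.charpoly = 0)
    (he : l = l⁻¹) :
    A ^ p ∈ Subgroup.center (SpecialLinearGroup (Fin 2) F) := by
  obtain ⟨h0, ht, hc⟩ := charpoly_map_eq_mul A hl
  rw [← he] at hc
  have h1 : l = 1 ∨ l = -1 := by
    rw [← sq_eq_one_iff, sq]; nth_rw 2 [he]; exact mul_inv_cancel₀ h0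
  obtain ⟨c, rfl⟩ : ∃ c : F, algebraMap F K c = l := by
    rcases h1 with rfl | rfl
    exacts [⟨1, by simp⟩, ⟨-1, by simp⟩]
  refine pow_mem_center_of_charpoly_dvd A (c := c ^ p) ?_
  have : A.1.charpoly = (X - C c) ^ 2 := by
    apply map_injective _ (algebraMap F K).injective
    rw [hc]; simp [sq]
  -- In characteristic `p`, `X ^ p - c ^ p = (X - c) ^ p`.
  rw [this, C_pow, ← sub_pow_char]
  exact pow_dvd_pow _ (Fact.out : p.Prime).two_le

theorem orderOf_psl_two_dvd {F : Type*} [Field F] [Finite F] (p : ℕ) [Fact p.Prime]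
    [CharP F p] (g : ProjectiveSpecialLinearGroup (Fin 2) F) :
    orderOf g ∣ p ∨ ∃ n, (n = Nat.card F - 1 ∨ n = Nat.card F + 1) ∧ orderOf g ∣ n / n.gcd 2 := by
  simp only [orderOf_dvd_iff_pow_eq_one]
  induction g using QuotientGroup.induction_on with | H A => ?_
  simp only [← QuotientGroup.mk_pow, QuotientGroup.eq_one_iff]
  let K := AlgebraicClosure F
  obtain ⟨l, hl⟩ : ∃ l : K, aeval l A.1.charpoly = 0 :=
    IsAlgClosed.exists_aeval_eq_zero K _ (by rw [charpoly_degree_eq_dim]; simp)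
  by_cases he : l = l⁻¹
  · exact Or.inl (pow_char_mem_center p A hl he)
  obtain ⟨h0, ht, hc⟩ := charpoly_map_eq_mul A hl
  have := Fintype.ofFinite F
  -- Frobenius fixes the coefficients, so `l ^ q` is again an eigenvalue.
  have hfrob : aeval (l ^ Nat.card F) A.1.charpoly = 0 := by
    rw [Nat.card_eq_fintype_card]
    have := congrArg (FiniteField.frobeniusAlgHom F K) hl
    rwa [← aeval_algHom_apply, map_zero] at this
  rw [aeval_def, ← eval_map, hc, eval_mul, mul_eq_zero] at hfrob
  simp only [eval_sub, eval_X, eval_C, sub_eq_zero] at hfrob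
  have hpos : 0 < Nat.card F := Nat.card_pos
  refine Or.inr ?_
  rcases hfrob with h | h
  · refine ⟨_, Or.inl rfl, pow_mem_center_of_root_pow A hl he (mul_right_cancel₀ h0 ?_)⟩
    rw [← pow_succ, Nat.sub_add_cancel hpos, h, one_mul]
  · refine ⟨_, Or.inr rfl, pow_mem_center_of_root_pow A hl he ?_⟩
    rw [pow_succ, h, inv_mul_cancel₀ h0]

theorem mem_range_algebraMap_of_pow_card {F K : Type*} [Field F] [Finite F] [Field K] [Algebra F K]
    {x : K} (hx : x ^ Nat.card F = x) : x ∈ (algebraMap F K).range := by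
  have hs : (X ^ Nat.card F - X : F[X]).Splits := by
    have := Fintype.ofFinite F
    rw [splits_iff_card_roots, Nat.card_eq_fintype_card, FiniteField.roots_X_pow_card_sub_X,
      FiniteField.X_pow_card_sub_X_natDegree_eq F Fintype.one_lt_card]
    rfl
  refine hs.mem_range_of_isRoot (FiniteField.X_pow_card_sub_X_ne_zero F Finite.one_lt_card) ?_
  simp [IsRoot, hx]

theorem vecMul_pow_eq_smul {R n : Type*} [CommRing R] [Fintype n] [DecidableEq n]
    {v : n → R} {B : Matrix n n R} {l : R} (h : v ᵥ* B = l • v) (k : ℕ) :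
    v ᵥ* B ^ k = l ^ k • v := by
  induction k with
  | zero => simp
  | succ k ih => rw [pow_succ, ← vecMul_vecMul, ih, smul_vecMul, h, smul_smul, pow_succ]

/-- For a primitive `n`-th root of unity `l`, Frobenius fixes `l + l⁻¹`, so a matrix over `F` has
eigenvalue `l`. If its `k`-th power is a scalar `c`, then `c ^ 2 = 1`, so `l ^ (2 * k) = 1`. -/
theorem exists_psl_two_dvd_two_mul_orderOf {F : Type*} [Field F] [Finite F] {n : ℕ}
    (hn : n = Nat.card F - 1 ∨ n = Nat.card F + 1) :
    ∃ g : ProjectiveSpecialLinearGroup (Fin 2) F, n ∣ 2 * orderOf g := by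
  let K := AlgebraicClosure F
  have := Fintype.ofFinite F
  have hpos : 0 < Nat.card F := Nat.card_pos
  have hq0 : (Nat.card F : F) = 0 := by rw [Nat.card_eq_fintype_card]; exact FiniteField.cast_card_eq_zero F
  have : NeZero (n : F) := ⟨by
    rcases hn with rfl | rfl
    · rw [Nat.cast_sub hpos, hq0]; simp
    · rw [Nat.cast_add, hq0]; simp⟩
  obtain ⟨l, hl⟩ := HasEnoughRootsOfUnity.exists_primitiveRoot K n
  have hl1 := hl.pow_eq_one
  have h0 : l ≠ 0 := by
    rintro rfl
    rw [zero_pow (NeZero.of_neZero_natCast F (n := n)).out] at hl1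
    exact zero_ne_one hl1
  obtain ⟨t, ht⟩ : l + l⁻¹ ∈ (algebraMap F K).range := by
    apply mem_range_algebraMap_of_pow_card
    have hadd : (l + l⁻¹) ^ Nat.card F = l ^ Nat.card F + l⁻¹ ^ Nat.card F := by
      rw [Nat.card_eq_fintype_card]
      exact map_add (FiniteField.frobeniusAlgHom F K) _ _
    rw [hadd]
    rcases hn with rfl | rfl
    · have : l ^ Nat.card F = l := by
        rw [← Nat.sub_add_cancel hpos, pow_succ, hl1, one_mul]
      rw [inv_pow, this]
    · have : l ^ Nat.card F = l⁻¹ := by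
        rw [pow_succ] at hl1
        exact eq_inv_of_mul_eq_one_left hl1
      rw [inv_pow, this, inv_inv, add_comm]
  let A : SpecialLinearGroup (Fin 2) F := ⟨!![0, -1; 1, t], by simp [det_fin_two]⟩
  refine ⟨(A : ProjectiveSpecialLinearGroup (Fin 2) F), ?_⟩
  set k := orderOf (A : ProjectiveSpecialLinearGroup (Fin 2) F) with hk
  have hcen : A ^ k ∈ Subgroup.center (SpecialLinearGroup (Fin 2) F) := by
    rw [← QuotientGroup.eq_one_iff, QuotientGroup.mk_pow, hk, pow_orderOf_eq_one]
  obtain ⟨c, hc, hA⟩ := Matrix.SpecialLinearGroup.mem_center_iff.1 hcen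
  have hv : ![1, l] ᵥ* (algebraMap F K).mapMatrix A.1 = l • ![1, l] := by
    ext i
    fin_cases i
    · simp [A, vecMul, dotProduct]
    · simp [A, vecMul, dotProduct, ht]
      linear_combination mul_inv_cancel₀ h0
  have hvk := congrFun (vecMul_pow_eq_smul hv k) 0
  have hA' : A.1 ^ k = scalar (Fin 2) c := hA.symm
  rw [← map_pow, hA'] at hvk
  have hlk : algebraMap F K c = l ^ k := by
    simpa [vecMul, dotProduct] using hvk
  rw [← hl.pow_eq_one_iff_dvd, mul_comm, pow_mul, ← hlk, ← map_pow]
  rw [Fintype.card_fin] at hc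
  rw [hc, map_one]

theorem exists_psl_two_orderOf_eq_char {F : Type*} [Field F] (p : ℕ) [Fact p.Prime]
    [CharP F p] : ∃ g : ProjectiveSpecialLinearGroup (Fin 2) F, orderOf g = p := by
  let A : SpecialLinearGroup (Fin 2) F :=
    SpecialLinearGroup.transvection (i := 0) (j := 1) (by decide) 1
  refine ⟨A, orderOf_eq_prime ?_ ?_⟩
  · rw [← QuotientGroup.mk_pow, QuotientGroup.eq_one_iff]
    refine pow_mem_center_of_charpoly_dvd A (c := 1) ?_
    have h2C : (C 2 : F[X]) = 2 := C_ofNat 2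
    have : A.1.charpoly = (X - C 1) ^ 2 := by
      rw [charpoly_fin_two, A.2]
      simp [A, SpecialLinearGroup.transvection, Matrix.transvection]
      linear_combination (-X) * h2C
    have h2 : (X ^ p - C 1 : F[X]) = (X - C 1) ^ p := by rw [sub_pow_char, ← C_pow, one_pow]
    rw [this, h2]
    exact pow_dvd_pow _ (Fact.out : p.Prime).two_le
  · rw [Ne, QuotientGroup.eq_one_iff, SpecialLinearGroup.transvection_mem_center_iff]
    exact one_ne_zero

end SpecialLinear

/-! ### Purity with an isolated vertex, and conclusion -/

theorem mem_primeSimplicialComplex_pair {G : Type*} [Group G] [Finite G] {g : G} {r s : ℕ}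
    (hr : r.Prime) (hs : s.Prime) (hne : r ≠ s) (hrg : r ∣ orderOf g) (hsg : s ∣ orderOf g) :
    {r, s} ∈ primeSimplicialComplex G := by
  have hG := orderOf_dvd_natCard g
  refine ⟨?_, g ^ (orderOf g / (r * s)), ?_⟩
  · intro t ht
    rw [Nat.mem_primeFactors]
    rcases Finset.mem_insert.1 ht with rfl | ht
    · exact ⟨hr, hrg.trans hG, Nat.card_pos.ne'⟩
    · rw [Finset.mem_singleton.1 ht]
      exact ⟨hs, hsg.trans hG, Nat.card_pos.ne'⟩
  · rw [Finset.prod_pair hne]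
    exact orderOf_pow_orderOf_div (orderOf_pos g).ne'
      (((Nat.coprime_primes hr hs).2 hne).mul_dvd_of_dvd_of_dvd hrg hsg)

theorem exists_isMaximalSimplex_superset {G : Type*} [Group G] [Finite G] {S : Finset ℕ}
    (hS : S ∈ primeSimplicialComplex G) :
    ∃ T, S ⊆ T ∧ IsMaximalSimplex (primeSimplicialComplex G) T := by
  have hfin : (primeSimplicialComplex G).Finite :=
    (Nat.card G).primeFactors.powerset.finite_toSet.subset fun T hT => by
      simpa using! hT.1
  exact hfin.exists_le_maximal hS

theorem isPureComplex_iff_of_isIsolatedVertex {G : Type*} [Group G] [Finite G] {v : ℕ}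
    (hv : IsIsolatedVertex (primeSimplicialComplex G) v) :
    IsPureComplex (primeSimplicialComplex G) ↔
      ∀ g : G, ∃ r k : ℕ, r.Prime ∧ orderOf g = r ^ k := by
  have hmax : IsMaximalSimplex (primeSimplicialComplex G) {v} :=
    ⟨hv.1, fun T hT hle => (hv.2 T hT (hle (Finset.mem_singleton_self v))).le⟩
  constructor
  · intro hpure g
    by_cases h1 : orderOf g = 1
    · exact ⟨2, 0, Nat.prime_two, h1⟩
    refine ⟨_, _, Nat.minFac_prime h1, Nat.eq_prime_pow_of_unique_prime_dvd (orderOf_pos g).ne' ?_⟩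
    intro d hd hdg
    by_contra hne
    obtain ⟨T, hST, hT⟩ := exists_isMaximalSimplex_superset <|
      mem_primeSimplicialComplex_pair hd (Nat.minFac_prime h1) hne hdg (Nat.minFac_dvd _)
    have hcard := Finset.card_le_card hST
    rw [Finset.card_pair hne, hpure T {v} hT hmax, Finset.card_singleton] at hcard
    omega
  · intro h
    have hone : ∀ S, IsMaximalSimplex (primeSimplicialComplex G) S → S.card = 1 := by
      intro S hS
      obtain ⟨hsub, g, hg⟩ := hS.1
      obtain ⟨r, k, hr, hk⟩ := h g
      have hle : S ⊆ {r} := fun s hs => by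
        have hsp := Nat.prime_of_mem_primeFactors (hsub hs)
        have : s ∣ r ^ k := hk ▸ hg ▸ Finset.dvd_prod_of_mem _ hs
        exact Finset.mem_singleton.2 ((Nat.prime_dvd_prime_iff_eq hsp hr).1 (hsp.dvd_of_dvd_pow this))
      rcases Finset.subset_singleton_iff.1 hle with rfl | rfl
      -- The empty simplex is not maximal, since it lies below `{v}`.
      · exact absurd (hS.2 hv.1 (Finset.empty_subset _) (Finset.mem_singleton_self v)) (by simp)
      · simp
    exact fun S T hS hT => (hone S hS).trans (hone T hT).symm

theorem isIsolatedVertex_psl_two {F : Type*} [Field F] [Finite F] (p : ℕ) [Fact p.Prime]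
    [CharP F p] : IsIsolatedVertex
      (primeSimplicialComplex (Matrix.ProjectiveSpecialLinearGroup (Fin 2) F)) p := by
  have hp : p.Prime := Fact.out
  constructor
  · obtain ⟨g, hg⟩ := exists_psl_two_orderOf_eq_char (F := F) p
    refine ⟨?_, g, by simpa using hg⟩
    rw [Finset.singleton_subset_iff, Nat.mem_primeFactors]
    exact ⟨hp, hg ▸ orderOf_dvd_natCard g, Nat.card_pos.ne'⟩
  · rintro S ⟨hS, g, hg⟩ hpS
    have hdvd : ∀ s ∈ S, s ∣ orderOf g := fun s hs => hg ▸ Finset.dvd_prod_of_mem _ hs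
    rcases orderOf_psl_two_dvd p g with h | ⟨n, hn, h⟩
    · refine Finset.eq_singleton_iff_unique_mem.2 ⟨hpS, fun s hs => ?_⟩
      exact (Nat.prime_dvd_prime_iff_eq (Nat.prime_of_mem_primeFactors (hS hs)) hp).1
        ((hdvd s hs).trans h)
    · have hpn : p ∣ n := (hdvd p hpS).trans (h.trans (Nat.div_dvd_of_dvd (Nat.gcd_dvd_left n 2)))
      have hpq : p ∣ Nat.card F := by
        have := Fintype.ofFinite F
        rw [Nat.card_eq_fintype_card, ← CharP.cast_eq_zero_iff F]
        exact FiniteField.cast_card_eq_zero F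
      have hpos : 0 < Nat.card F := Nat.card_pos
      -- `p` would divide both `q` and `q ∓ 1`.
      refine absurd ?_ hp.one_lt.ne'
      rw [← Nat.dvd_one]
      rcases hn with rfl | rfl
      · exact (Nat.dvd_sub_iff_right (by omega) hpq).1 hpn
      · exact (Nat.dvd_add_right hpq).1 hpn

theorem exists_prime_pow_eq_div_gcd {q n : ℕ} (hq : q ∈ ({4, 5, 7, 8, 9, 17} : Set ℕ))
    (hn : n = q - 1 ∨ n = q + 1) : ∃ r k : ℕ, r.Prime ∧ n / n.gcd 2 = r ^ k := by
  have h : n / n.gcd 2 ∈ ({2 ^ 1, 2 ^ 2, 2 ^ 3, 3 ^ 1, 3 ^ 2, 5 ^ 1, 7 ^ 1} : Set ℕ) := by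
    simp only [Set.mem_insert_iff, Set.mem_singleton_iff] at hq
    rcases hq with rfl | rfl | rfl | rfl | rfl | rfl <;> rcases hn with rfl | rfl <;> simp
  rcases h with h | h | h | h | h | h | h <;> exact ⟨_, _, by norm_num, h⟩

theorem mainTheorem7 {F : Type*} [Field F] [Finite F] (p : ℕ) [CharP F p]
    (hq : 4 ≤ Nat.card F) :
    (IsPureComplex (primeSimplicialComplex (Matrix.ProjectiveSpecialLinearGroup (Fin 2) F)) ↔
      Nat.card F ∈ ({4, 5, 7, 8, 9, 17} : Set ℕ)) ∧
    IsIsolatedVertex (primeSimplicialComplex (Matrix.ProjectiveSpecialLinearGroup (Fin 2) F)) p ∧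
    (IsPureComplex (primeSimplicialComplex (Matrix.ProjectiveSpecialLinearGroup (Fin 2) F)) ↔
      ∀ g : Matrix.ProjectiveSpecialLinearGroup (Fin 2) F,
        ∃ r k : ℕ, r.Prime ∧ orderOf g = r ^ k) := by
  obtain ⟨m, hp, hm⟩ : ∃ m : ℕ+, p.Prime ∧ Nat.card F = p ^ (m : ℕ) := by
    have := Fintype.ofFinite F
    rw [Nat.card_eq_fintype_card]
    exact FiniteField.card F p
  have : Fact p.Prime := ⟨hp⟩
  have hiso := isIsolatedVertex_psl_two (F := F) p
  have hpure := isPureComplex_iff_of_isIsolatedVertex hiso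
  refine ⟨hpure.trans ⟨fun h => ?_, fun h g => ?_⟩, hiso, hpure⟩
  · obtain ⟨g₁, h₁⟩ := exists_psl_two_dvd_two_mul_orderOf (F := F) (Or.inl rfl)
    obtain ⟨g₂, h₂⟩ := exists_psl_two_dvd_two_mul_orderOf (F := F) (Or.inr rfl)
    obtain ⟨r, k, hr, hk⟩ := h g₁
    obtain ⟨s, l, hs, hl⟩ := h g₂
    exact card_mem_of_dvd_two_mul_prime_pow hp hr hs hm hq (hk ▸ h₁) (hl ▸ h₂)
  · obtain ⟨r, k, hr, hk⟩ : ∃ r k : ℕ, r.Prime ∧ orderOf g ∣ r ^ k := by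
      rcases orderOf_psl_two_dvd p g with h' | ⟨n, hn, h'⟩
      · exact ⟨p, 1, hp, by rwa [pow_one]⟩
      · obtain ⟨r, k, hr, hk⟩ := exists_prime_pow_eq_div_gcd h hn
        exact ⟨r, k, hr, hk ▸ h'⟩
    obtain ⟨j, -, hj⟩ := (Nat.dvd_prime_pow hr).1 hk
    exact ⟨r, j, hr, hj⟩
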